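/- Let $L$ be a first-order language, $\kappa$ an uncountable cardinal, and $\mathfrak C$ a $\kappa$-saturated and strongly $\kappa$-homogeneous $L$-structure (a monster model of its complete theory). Tuples $a,b,\dots$ of elements of $\mathfrak C$ may be infinite, of length less than $\kappa$, and $A\subseteq\mathfrak C$ is a set of parameters with $|A|<\kappa$; $ab$ is the concatenation of $a$ and $b$, and $Aa$ is the union of $A$ with the set of entries of $a$. For a partial type $p(x)$ with parameters in $\mathfrak C$ and an ordinal $\alpha$, write $\alpha_+\le DD(p)$ (the dividing depth of $p$ is at least $\alpha$, and $\alpha$ is attained) if there exist $L$-formulas $(\varphi_j(x,y_j): j<\alpha)$ with $y_j$ a finite tuple of variables, natural numbers $(k_j:j<\alpha)$, and a tree of finite tuples of parameters $(c_{s,i}: s\in\omega^{<\alpha},\ i<\omega)$ in $\mathfrak C$ such that (a) for each $s\in\omega^{<\alpha}$, the family $(\varphi_{|s|}(x,c_{s,i}): i<\omega)$ is $k_{|s|}$-inconsistent (the formulas at any $k_{|s|}$ distinct indices $i$ are jointly inconsistent), and (b) for each $f:\alpha\to\omega$, the set $p(x)\cup\{\varphi_j(x,c_{f\upharpoonright j,\,f(j)}):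 j<\alpha\}$ is consistent. Here $\omega^{<\alpha}$ is the set of functions $s$ from an ordinal $|s|<\alpha$ to $\omega$. Write $\alpha_+\le DD(a/A)$ for $\alpha_+\le DD(\mathrm{tp}(a/A))$, and let $\oplus$ denote the natural (Hessenberg) sum of ordinals. Proposition. Let $\alpha$ be an ordinal with $|\alpha|<\kappa$. If $\alpha_+\le DD(ab/A)$, then there are ordinals $\beta,\gamma$ such that $\alpha\le\beta\oplus\gamma$, $\beta_+\le DD(a/A)$ and $\gamma_+\le DD(b/Aa)$. -/

import Mathlib

open FirstOrder Cardinal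

universe u v w

/-- The natural (Hessenberg) sum of ordinals: `natSum a b` is the least ordinal that is strictly
greater than every `natSum a' b` with `a' < a` and every `natSum a b'` with `b' < b`. -/
noncomputable def natSum (a b : Ordinal.{w}) : Ordinal.{w} :=
  max (⨆ x : Set.Iio a, Order.succ (natSum x.1 b)) (⨆ x : Set.Iio b, Order.succ (natSum a x.1))
termination_by (a, b)
decreasing_by
  · exact Prod.Lex.left _ _ x.2
  · exact Prod.Lex.right _ x.2

namespace DividingDepth

/-- Formulas in the tuple of variables `x = (x_i)_{i ∈ I}` with parameters from `M`: an `L`-formula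
whose free variables are the elements of `M` (the parameters, each interpreted as itself) and the
indices in `I`. -/
abbrev PFormula (L : FirstOrder.Language.{u, v}) (M : Type w) (I : Type w) := L.Formula (M ⊕ I)

section

variable {L : FirstOrder.Language.{u, v}} {M : Type w} [L.Structure M] {I : Type w}

/-- The tuple `x` satisfies the formula `ψ` with parameters in `M`. -/
def Sat (x : I → M) (ψ : PFormula L M I) : Prop :=
  ψ.Realize (Sum.elim id x)

/-- A set of formulas with parameters in `M` is consistent (with the elementary diagram of `M`):
each of its finite subsets is realized in `M`. -/
def Consistent (p : Set (PFormula L M I)) : Prop :=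
  ∀ F : Finset (PFormula L M I), (F : Set (PFormula L M I)) ⊆ p →
    ∃ x : I → M, ∀ ψ ∈ F, Sat x ψ

/-- The formula `φ(x, c)` obtained by substituting the parameters `c` for the variables `y` of the
`L`-formula `φ(x, y)`. -/
def inst {n : ℕ} (φ : L.Formula (I ⊕ Fin n)) (c : Fin n → M) : PFormula L M I :=
  φ.relabel (Sum.elim Sum.inr (fun m => Sum.inl (c m)))

/-- The set of formulas over `A` (i.e. with parameters in `A`). -/
def formulasOver (L : FirstOrder.Language.{u, v}) (A : Set M) (I : Type w) : Set (PFormula L M I) :=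
  Set.range fun ψ : L.Formula (A ⊕ I) => ψ.relabel (Sum.map Subtype.val id)

/-- The complete type `tp(a/A)`. -/
def tp (L : FirstOrder.Language.{u, v}) [L.Structure M] (a : I → M) (A : Set M) : Set (PFormula L M I) :=
  {ψ ∈ formulasOver L A I | Sat a ψ}

/-- The family `(φ(x, c i))_{i < ω}` is `k`-inconsistent: for any `k` distinct indices, the
corresponding formulas are jointly inconsistent. -/
def KInconsistent {n : ℕ} (φ : L.Formula (I ⊕ Fin n)) (c : ℕ → Fin n → M) (k : ℕ) : Prop :=
  ∀ S : Finset ℕ, S.card = k → ¬ ∃ x : I → M, ∀ i ∈ S, Sat x (inst φ (c i))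

/-- The restriction `f ↾ j` of `f : α → ω` to `j < α`. -/
def restrict {α : Ordinal.{w}} (f : Set.Iio α → ℕ) (j : Set.Iio α) : Set.Iio (j : Ordinal.{w}) → ℕ :=
  fun l => f ⟨l, Set.mem_Iio.mpr (lt_trans (Set.mem_Iio.mp l.2) (Set.mem_Iio.mp j.2))⟩

/-- `α₊ ≤ DD(p)`: there is a tree of depth `α` in `p`, that is, formulas `φ_j(x, y_j) ∈ L` and
numbers `k_j` (`j < α`), and a tree of parameters `c_{s,i}` (`s ∈ ω^{<α}`, `i < ω`) such that each
`{φ_{|s|}(x, c_{s,i}) : i < ω}` is `k_{|s|}`-inconsistent and, for each `f : α → ω`,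
`p(x) ∪ {φ_j(x, c_{f ↾ j, f(j)}) : j < α}` is consistent.  A node `s ∈ ω^{<α}` is given by its
length `j < α` and a function `s : j → ω`. -/
def PlusLeDD (p : Set (PFormula L M I)) (α : Ordinal.{w}) : Prop :=
  ∃ (n : Set.Iio α → ℕ) (φ : ∀ j : Set.Iio α, L.Formula (I ⊕ Fin (n j))) (k : Set.Iio α → ℕ)
    (c : ∀ j : Set.Iio α, (Set.Iio (j : Ordinal.{w}) → ℕ) → ℕ → Fin (n j) → M),
    (∀ (j : Set.Iio α) (s : Set.Iio (j : Ordinal.{w}) → ℕ), KInconsistent (φ j) (c j s) (k j)) ∧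
    ∀ f : Set.Iio α → ℕ,
      Consistent (p ∪ Set.range fun j : Set.Iio α => inst (φ j) (c j (restrict f j) (f j)))

end

/-- `M` is `κ`-saturated: every consistent set of formulas in one variable over a set of fewer than
`κ` parameters is realized in `M`. -/
def IsSaturated (L : FirstOrder.Language.{u, v}) (M : Type w) [L.Structure M] (κ : Cardinal.{w}) : Prop :=
  ∀ A : Set M, #A < κ → ∀ p ⊆ formulasOver L A PUnit.{w + 1}, Consistent p →
    ∃ x : PUnit.{w + 1} → M, ∀ ψ ∈ p, Sat x ψ

/-- `M` is strongly `κ`-homogeneous: every partial elementary map of `M` whose domain has fewer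
than `κ` elements extends to an automorphism of `M`. -/
def IsStronglyHomogeneous (L : FirstOrder.Language.{u, v}) (M : Type w) [L.Structure M]
    (κ : Cardinal.{w}) : Prop :=
  ∀ A : Set M, #A < κ → ∀ g : A → M,
    (∀ ψ : L.Formula A, ψ.Realize (Subtype.val : A → M) ↔ ψ.Realize g) →
      ∃ σ : M ≃[L] M, ∀ a : A, σ a = g a

end DividingDepth

/-! A dividing tree is traded for a linear object. A tree of depth `α` in `tp(a/A)` exists if and
only if there is a chain of formulas, indexed by a well-order of type `α` and all satisfied by `a`,
each dividing over `A` and the parameters of the earlier ones. From tree to chain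
(`HasTree.exists_divStep`), compactness and the pigeonhole principle find a branch along which each
parameter has infinitely many siblings of the same type over what precedes it. From chain to tree
(`hasTree_of_divStep`), the automorphisms witnessing division are composed along branches.

For chains, additivity is checked one step at a time. By `DivStep.split`, if a formula true of `ab`
divides over `B`, then a formula true of `a` divides over `B`, or one true of `b` divides over `Ba`.
This splits the index order into a set and its complement, which give chains for `a` over `A` and
for `b` over `Aa`. By `type_le_natSum`, the order type of the whole is at most the natural sum of
the types of the two parts. -/

namespace DividingDepth

/-! ### Definability as a property of predicates on tuples -/

section Definable

variable {L : FirstOrder.Language.{u, v}} {M : Type w} [L.Structure M]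

theorem sat_inst {I : Type w} {n : ℕ} (φ : L.Formula (I ⊕ Fin n)) (c : Fin n → M) (x : I → M) :
    Sat x (inst φ c) ↔ φ.Realize (Sum.elim x c) := by
  unfold Sat inst
  rw [Language.Formula.realize_relabel]
  have : (Sum.elim id x ∘ Sum.elim Sum.inr fun m => Sum.inl (c m) : I ⊕ Fin n → M)
      = Sum.elim x c := by
    funext t; cases t <;> rfl
  rw [this]

/-- A predicate on tuples is definable without parameters. -/
def IsDef (L : FirstOrder.Language.{u, v}) {M : Type w} [L.Structure M] {V : Type*}
    (P : (V → M) → Prop) : Prop :=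
  ∃ χ : L.Formula V, ∀ v, χ.Realize v ↔ P v

/-- A predicate on tuples depends only on the coordinates in `E`. -/
def SupportedBy {M : Type w} {V : Type*} (E : Finset V) (P : (V → M) → Prop) : Prop :=
  ∀ v v' : V → M, (∀ t ∈ E, v t = v' t) → (P v ↔ P v')

variable {V W X T : Type*}

theorem isDef_realize (χ : L.Formula V) : IsDef L (M := M) fun v => χ.Realize v :=
  ⟨χ, fun _ => Iff.rfl⟩

theorem IsDef.congr {P Q : (V → M) → Prop} (h : IsDef L P) (hPQ : ∀ v, P v ↔ Q v) : IsDef L Q :=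
  let ⟨χ, hχ⟩ := h
  ⟨χ, fun v => (hχ v).trans (hPQ v)⟩

theorem IsDef.comp {P : (V → M) → Prop} (h : IsDef L P) (g : V → W) :
    IsDef L fun w : W → M => P (w ∘ g) :=
  let ⟨χ, hχ⟩ := h
  ⟨χ.relabel g, fun _ => Language.Formula.realize_relabel.trans (hχ _)⟩

theorem IsDef.not {P : (V → M) → Prop} (h : IsDef L P) : IsDef L fun v => ¬ P v :=
  let ⟨χ, hχ⟩ := h
  ⟨χ.not, fun v => by rw [Language.Formula.realize_not, hχ]⟩

theorem IsDef.and {P Q : (V → M) → Prop} (hP : IsDef L P) (hQ : IsDef L Q) :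
    IsDef L fun v => P v ∧ Q v :=
  let ⟨χ, hχ⟩ := hP
  let ⟨ξ, hξ⟩ := hQ
  ⟨χ ⊓ ξ, fun v => by rw [Language.Formula.realize_inf, hχ, hξ]⟩

theorem IsDef.iff {P Q : (V → M) → Prop} (hP : IsDef L P) (hQ : IsDef L Q) :
    IsDef L fun v => (P v ↔ Q v) :=
  let ⟨χ, hχ⟩ := hP
  let ⟨ξ, hξ⟩ := hQ
  ⟨χ.iff ξ, fun v => by rw [Language.Formula.realize_iff, hχ, hξ]⟩

theorem IsDef.forall_mem {P : T → (V → M) → Prop} (s : Finset T) (h : ∀ t ∈ s, IsDef L (P t)) :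
    IsDef L fun v => ∀ t ∈ s, P t v := by
  choose χ hχ using h
  refine ⟨Language.Formula.iInf fun t : s => χ t.1 t.2, fun v => ?_⟩
  rw [Language.Formula.realize_iInf]
  exact ⟨fun h t ht => (hχ t ht v).1 (h ⟨t, ht⟩), fun h t => (hχ t.1 t.2 v).2 (h t.1 t.2)⟩

theorem IsDef.exists_supportedBy {P : (V → M) → Prop} (h : IsDef L P) :
    ∃ E : Finset V, SupportedBy E P := by
  classical
  obtain ⟨χ, hχ⟩ := h
  refine ⟨χ.freeVarFinset, fun v v' hv => ?_⟩
  rw [← hχ, ← hχ]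
  have h1 := Language.BoundedFormula.realize_restrictFreeVar (φ := χ) (f := id)
    (v := fun t => v t.1) (xs := default) v (fun t => rfl)
  have h2 := Language.BoundedFormula.realize_restrictFreeVar (φ := χ) (f := id)
    (v := fun t => v t.1) (xs := default) v' (fun t => hv _ t.2)
  exact h1.symm.trans h2

/-- A definable predicate mentions only finitely many of its variables from `X`. -/
theorem IsDef.exists_finite_vars {P : (V ⊕ X → M) → Prop} (h : IsDef L P) :
    ∃ (n : ℕ) (χ : L.Formula (V ⊕ Fin n)) (g : Fin n ↪ X),
      ∀ v x, χ.Realize (Sum.elim v (x ∘ g)) ↔ P (Sum.elim v x) := by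
  classical
  obtain ⟨χ, hχ⟩ := h
  let E : Finset X := χ.freeVarFinset.preimage Sum.inr Sum.inr_injective.injOn
  let e := E.equivFin
  refine ⟨E.card, χ.restrictFreeVar fun t => match t with
    | ⟨Sum.inl a, _⟩ => Sum.inl a
    | ⟨Sum.inr b, hb⟩ => Sum.inr (e ⟨b, by simpa [E] using hb⟩),
    e.symm.toEmbedding.trans (Function.Embedding.subtype _), fun v x => ?_⟩
  rw [← hχ]
  refine Language.BoundedFormula.realize_restrictFreeVar _ ?_
  rintro ⟨a | b, hb⟩ <;> simp

theorem IsDef.exists_tuple [Nonempty M] {P : (V ⊕ X → M) → Prop} (h : IsDef L P) :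
    IsDef L fun v => ∃ x : X → M, P (Sum.elim v x) := by
  obtain ⟨n, χ, g, hg⟩ := h.exists_finite_vars
  refine ⟨χ.iExs (Fin n), fun v => ?_⟩
  rw [Language.Formula.realize_iExs]
  constructor
  · rintro ⟨y, hy⟩
    obtain ⟨x, rfl⟩ : ∃ x : X → M, x ∘ g = y :=
      ⟨Function.extend g y fun _ => Classical.arbitrary M,
        funext fun t => g.injective.extend_apply _ _ _⟩
    exact ⟨x, (hg v x).1 hy⟩
  · rintro ⟨x, hx⟩
    exact ⟨x ∘ g, (hg v x).2 hx⟩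

theorem IsDef.map_iff {P : (V → M) → Prop} (h : IsDef L P) (σ : M ≃[L] M) (v : V → M) :
    P (σ ∘ v) ↔ P v := by
  obtain ⟨χ, hχ⟩ := h
  rw [← hχ, ← hχ]
  exact Language.StrongHomClass.realize_formula σ χ

/-- A predicate on tuples is definable with parameters from the tuple `p`. -/
def DefOver (L : FirstOrder.Language.{u, v}) {M : Type w} [L.Structure M] {V Z : Type*}
    (p : V → M) (R : (Z → M) → Prop) : Prop :=
  ∃ P : (V ⊕ Z → M) → Prop, IsDef L P ∧ ∀ z, P (Sum.elim p z) ↔ R z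

variable {Z : Type*} {p : V → M}

theorem DefOver.comp {R : (Z → M) → Prop} (h : DefOver L p R) (g : Z → X) :
    DefOver L p fun x : X → M => R (x ∘ g) := by
  obtain ⟨P, hP, hR⟩ := h
  refine ⟨_, hP.comp (Sum.map id g), fun z => ?_⟩
  refine Iff.trans ?_ (hR (z ∘ g))
  have : (Sum.elim p z ∘ Sum.map id g : V ⊕ Z → M) = Sum.elim p (z ∘ g) := by
    funext t; cases t <;> rfl
  rw [this]

theorem DefOver.iff {R Q : (Z → M) → Prop} (hR : DefOver L p R) (hQ : DefOver L p Q) :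
    DefOver L p fun z => (R z ↔ Q z) := by
  obtain ⟨P, hP, hR⟩ := hR
  obtain ⟨P', hP', hQ⟩ := hQ
  exact ⟨_, hP.iff hP', fun z => iff_congr (hR z) (hQ z)⟩

theorem DefOver.forall_mem {R : T → (Z → M) → Prop} (s : Finset T)
    (h : ∀ t ∈ s, DefOver L p (R t)) : DefOver L p fun z => ∀ t ∈ s, R t z := by
  classical
  choose! P hP hR using h
  exact ⟨_, IsDef.forall_mem s hP, fun z => forall₂_congr fun t ht => hR t ht z⟩

theorem IsDef.defOver {R : (Z → M) → Prop} (h : IsDef L R) (p : V → M) : DefOver L p R :=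
  ⟨_, h.comp Sum.inr, fun _ => Iff.rfl⟩

/-- Quantifying out coordinate `j` leaves a predicate that does not depend on it. This is what
pushes a condition at stage `j` of the saturation argument down to earlier coordinates. -/
theorem DefOver.exists_update [DecidableEq Z] [Nonempty M] {R : (Z → M) → Prop}
    (h : DefOver L p R) (j : Z) : DefOver L p fun z => ∃ y, R (Function.update z j y) := by
  classical
  obtain ⟨P, hP, hR⟩ := h
  refine ⟨_, (hP.comp fun t : V ⊕ Z => if t = Sum.inr j then (Sum.inr () : (V ⊕ Z) ⊕ Unit)
    else Sum.inl t).exists_tuple, fun z => ?_⟩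
  have key : ∀ x : Unit → M, (Sum.elim (Sum.elim p z) x ∘ fun t : V ⊕ Z =>
      if t = Sum.inr j then (Sum.inr () : (V ⊕ Z) ⊕ Unit) else Sum.inl t)
        = Sum.elim p (Function.update z j (x ())) := by
    intro x
    funext t
    rcases t with t | t
    · simp
    · by_cases ht : t = j
      · subst ht; simp
      · simp [ht]
  constructor
  · rintro ⟨x, hx⟩
    rw [key, hR] at hx
    exact ⟨_, hx⟩
  · rintro ⟨y, hy⟩
    refine ⟨fun _ => y, ?_⟩
    rw [key, hR]
    exact hy

theorem DefOver.exists_supportedBy {R : (Z → M) → Prop} (h : DefOver L p R) :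
    ∃ E : Finset Z, SupportedBy E R := by
  classical
  obtain ⟨P, hP, hR⟩ := h
  obtain ⟨E, hE⟩ := hP.exists_supportedBy
  refine ⟨E.preimage Sum.inr Sum.inr_injective.injOn, fun z z' hz => ?_⟩
  rw [← hR, ← hR]
  refine hE _ _ ?_
  rintro (t | t) ht
  · rfl
  · exact hz t (by simpa using ht)

end Definable

/-! ### Conjugacy of tuples -/

section Homogeneity

variable {L : FirstOrder.Language.{u, v}} {M : Type w} [L.Structure M] {κ : Cardinal.{w}}

/-- In a strongly homogeneous structure, tuples with the same type are conjugate. -/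
theorem IsStronglyHomogeneous.exists_equiv (hhom : IsStronglyHomogeneous L M κ) {X : Type*}
    (x y : X → M) (hx : #(Set.range x) < κ)
    (hxy : ∀ P : (X → M) → Prop, IsDef L P → P x → P y) :
    ∃ σ : M ≃[L] M, ∀ t, σ (x t) = y t := by
  have hiff : ∀ P : (X → M) → Prop, IsDef L P → (P x ↔ P y) := fun P hP =>
    ⟨hxy P hP, fun h => by_contra fun h' => hxy _ hP.not h' h⟩
  choose r hr using fun m : Set.range x => m.2
  obtain ⟨σ, hσ⟩ := hhom (Set.range x) hx (fun m => y (r m)) (fun ψ => by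
    have h1 := hiff _ ((isDef_realize ψ).comp r)
    have h2 : x ∘ r = Subtype.val := funext hr
    rw [h2] at h1
    exact h1)
  refine ⟨σ, fun t => ?_⟩
  have h1 := hσ ⟨x t, t, rfl⟩
  refine h1.trans ?_
  -- The map was defined through chosen preimages `r`; it is independent of the choice because
  -- equalities between entries belong to the type.
  have h2 := hxy (fun z => z (r ⟨x t, t, rfl⟩) = z t)
    ⟨Language.Term.equal (Language.Term.var (r ⟨x t, t, rfl⟩)) (Language.Term.var t), fun z => by
      simp [Language.Formula.realize_equal]⟩
  exact h2 (hr ⟨x t, t, rfl⟩)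

end Homogeneity

/-! ### Dependent choice along a well-order -/

section Recursion

/-- Dependent choice along a well-order, for conditions that depend only on earlier values. -/
theorem exists_forall_of_wellFoundedLT {X : Type*} [LinearOrder X] [WellFoundedLT X]
    {C : X → Type*} [∀ j, Nonempty (C j)] (Q : ∀ j, (∀ l, C l) → C j → Prop)
    (hloc : ∀ j f g, (∀ l < j, f l = g l) → ∀ m, Q j f m → Q j g m)
    (hex : ∀ j f, (∀ l < j, Q l f (f l)) → ∃ m, Q j f m) :
    ∃ f : ∀ j, C j, ∀ j, Q j f (f j) := by
  classical
  -- The arbitrary values from `j` on are harmless: by `hloc` the condition at `j` does not see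
  -- them.
  let ext : ∀ j, (∀ l, l < j → C l) → ∀ l, C l := fun j f l =>
    if h : l < j then f l h else Classical.arbitrary _
  let f : ∀ j, C j := (wellFounded_lt (α := X)).fix fun j f =>
    if h : ∃ m, Q j (ext j f) m then h.choose else Classical.arbitrary _
  have hf : ∀ j, f j = if h : ∃ m, Q j (ext j fun l _ => f l) m then h.choose
      else Classical.arbitrary _ := fun j => (wellFounded_lt (α := X)).fix_eq _ j
  refine ⟨f, fun j => ?_⟩
  induction j using (wellFounded_lt (α := X)).induction with
  | _ j ih =>
    have hagree : ∀ l < j, f l = ext j (fun l _ => f l) l := fun l hl => by simp [ext, hl]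
    obtain ⟨m, hm⟩ := hex j f ih
    have h : ∃ m, Q j (ext j fun l _ => f l) m := ⟨m, hloc _ _ _ hagree _ hm⟩
    have h2 := h.choose_spec
    refine hloc j _ f (fun l hl => (hagree l hl).symm) _ ?_
    rw [hf j, dif_pos h]
    exact h2

end Recursion


/-! ### From one variable to fewer than `κ` variables -/

section Saturation

variable {L : FirstOrder.Language.{u, v}} {M : Type w} [L.Structure M] {κ : Cardinal.{w}}

theorem mk_union_lt (hκ : ℵ₀ < κ) {A B : Set M} (hA : #A < κ) (hB : #B < κ) :
    #(A ∪ B : Set M) < κ :=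
  (mk_union_le A B).trans_lt (add_lt_of_lt hκ.le hA hB)

theorem mk_range_lt {X : Type w} (hX : #X < κ) (f : X → M) : #(Set.range f) < κ :=
  mk_range_le.trans_lt hX

theorem exists_mem_formulasOver {V : Type*} {I : Type w} {p : V → M} {R : (I → M) → Prop}
    (h : DefOver L p R) {B : Set M} (hB : Set.range p ⊆ B) :
    ∃ ψ ∈ formulasOver L B I, ∀ x, Sat x ψ ↔ R x := by
  obtain ⟨P, ⟨χ, hχ⟩, hR⟩ := h
  refine ⟨_, ⟨χ.relabel (Sum.map (fun t => ⟨p t, hB ⟨t, rfl⟩⟩) id), rfl⟩, fun x => ?_⟩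
  rw [← hR, ← hχ]
  unfold Sat
  rw [Language.Formula.realize_relabel, Language.Formula.realize_relabel]
  have : ((Sum.elim id x ∘ Sum.map Subtype.val id) ∘
      Sum.map (fun t => (⟨p t, hB ⟨t, rfl⟩⟩ : B)) id : V ⊕ I → M) = Sum.elim p x := by
    funext t; cases t <;> rfl
  rw [this]

theorem defOver_of_mem_formulasOver {I : Type w} {B : Set M} {ψ : PFormula L M I}
    (h : ψ ∈ formulasOver L B I) : DefOver L (Subtype.val : B → M) fun x => Sat x ψ := by
  obtain ⟨χ, rfl⟩ := h
  refine ⟨_, isDef_realize χ, fun x => ?_⟩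
  unfold Sat
  simp only [Language.Formula.realize_relabel]
  have : (Sum.elim id x ∘ Sum.map Subtype.val id : B ⊕ I → M) = Sum.elim Subtype.val x := by
    funext t; cases t <;> rfl
  rw [this]

/-- A finitely satisfiable family of predicates in one variable, definable over fewer than `κ`
parameters, is satisfiable in a `κ`-saturated structure. -/
theorem IsSaturated.exists_forall_one (hsat : IsSaturated L M κ) {V Γ : Type*} {p : V → M}
    (hp : #(Set.range p) < κ) (R : Γ → M → Prop)
    (hR : ∀ γ, DefOver L p fun x : PUnit.{w + 1} → M => R γ (x PUnit.unit))
    (hfin : ∀ F : Finset Γ, ∃ x, ∀ γ ∈ F, R γ x) : ∃ x, ∀ γ, R γ x := by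
  classical
  choose ψ hψ hψR using fun γ => exists_mem_formulasOver (hR γ) subset_rfl
  obtain ⟨x, hx⟩ := hsat _ hp (Set.range ψ) (by rintro _ ⟨γ, rfl⟩; exact hψ γ) (by
    intro F hF
    obtain ⟨G, rfl⟩ : ∃ G : Finset Γ, G.image ψ = F := by
      obtain ⟨G, -, hG⟩ := Finset.subset_set_image_iff.1
        (by simpa using hF : (F : Set _) ⊆ ψ '' Set.univ)
      exact ⟨G, hG⟩
    obtain ⟨x, hx⟩ := hfin G
    refine ⟨fun _ => x, fun θ hθ => ?_⟩
    obtain ⟨γ, hγ, rfl⟩ := Finset.mem_image.1 hθ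
    exact (hψR γ _).2 (hx γ hγ))
  exact ⟨x PUnit.unit, fun γ => (hψR γ x).1 (hx _ ⟨γ, rfl⟩)⟩

/-- A finitely satisfiable family of predicates in fewer than `κ` variables, definable over fewer
than `κ` parameters, is satisfiable in a `κ`-saturated structure. -/
theorem IsSaturated.exists_forall [Nonempty M] (hκ : ℵ₀ < κ) (hsat : IsSaturated L M κ)
    {V Γ : Type*} {Z : Type w} (hZ : #Z < κ) {p : V → M}
    (hp : #(Set.range p) < κ) (R : Γ → (Z → M) → Prop) (hR : ∀ γ, DefOver L p (R γ))
    (hfin : ∀ F : Finset Γ, ∃ z, ∀ γ ∈ F, R γ z) : ∃ z, ∀ γ, R γ z := by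
  classical
  choose x hx using hfin
  -- The ultrafilter limit of the finite solutions is a complete type in all the variables that
  -- contains every `R γ`; it is realized one coordinate at a time.
  let U : Ultrafilter (Finset Γ) := Ultrafilter.of Filter.atTop
  have hU : ∀ γ, ∀ᶠ F in (U : Filter (Finset Γ)), R γ (x F) := fun γ =>
    Ultrafilter.of_le _ ((Filter.eventually_ge_atTop {γ}).mono fun F hF =>
      hx F γ (hF (Finset.mem_singleton_self γ)))
  obtain ⟨_, _⟩ := exists_wellFoundedLT Z
  let Q : ∀ j : Z, (Z → M) → M → Prop := fun j g m =>
    ∀ (S : (Z → M) → Prop) (E : Finset Z), DefOver L p S → SupportedBy E S → (∀ e ∈ E, e ≤ j) →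
      (∀ᶠ F in (U : Filter (Finset Γ)), S (x F)) → S (Function.update g j m)
  have below : ∀ (C : Set Z) (g : Z → M), (∀ l ∈ C, Q l g (g l)) →
      ∀ (S : (Z → M) → Prop) (E : Finset Z), DefOver L p S → SupportedBy E S → (∀ e ∈ E, e ∈ C) →
      (∀ᶠ F in (U : Filter (Finset Γ)), S (x F)) → S g := by
    intro C g hg S E hS hE hEC hSU
    rcases E.eq_empty_or_nonempty with rfl | hne
    · obtain ⟨F, hF⟩ := hSU.exists
      exact (hE _ _ (by simp)).1 hF
    · have := hg (E.max' hne) (hEC _ (E.max'_mem hne)) S E hS hE (fun e he => E.le_max' e he) hSU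
      rwa [Function.update_eq_self] at this
  obtain ⟨g, hg⟩ := exists_forall_of_wellFoundedLT (C := fun _ : Z => M) Q (by
    intro j f g hfg m hm S E hS hE hEj hSU
    refine (hE _ _ fun t ht => ?_).1 (hm S E hS hE hEj hSU)
    rcases (hEj t ht).eq_or_lt with rfl | hlt
    · simp
    · simp [hlt.ne, hfg t hlt]) (by
    intro j g hg
    let Δ := {S : (Z → M) → Prop // DefOver L p S ∧ (∃ E, SupportedBy E S ∧ ∀ e ∈ E, e ≤ j) ∧
      ∀ᶠ F in (U : Filter (Finset Γ)), S (x F)}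
    obtain ⟨m, hm⟩ := hsat.exists_forall_one (V := V ⊕ Set.Iio j) (Γ := Δ)
      (p := Sum.elim p fun l => g l) (by
        rw [Set.Sum.elim_range]
        exact mk_union_lt hκ hp (mk_range_lt ((mk_set_le _).trans_lt hZ) _))
      (fun S y => S.1 (Function.update g j y)) (by
        rintro ⟨S, ⟨P, hP, hPS⟩, ⟨E, hE, hEj⟩, -⟩
        refine ⟨_, hP.comp (Sum.elim (fun t => Sum.inl (Sum.inl t)) fun t =>
          if h : t < j then Sum.inl (Sum.inr ⟨t, h⟩) else Sum.inr PUnit.unit), fun y => ?_⟩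
        have : (Sum.elim (Sum.elim p fun l : Set.Iio j => g l) y ∘
          Sum.elim (fun t => Sum.inl (Sum.inl t)) fun t =>
            if h : t < j then Sum.inl (Sum.inr ⟨t, h⟩) else Sum.inr PUnit.unit : V ⊕ Z → M) =
            Sum.elim p fun t => if t < j then g t else y PUnit.unit := by
          funext t
          rcases t with t | t
          · rfl
          · by_cases h : t < j <;> simp [h]
        rw [this, hPS]
        refine hE _ _ fun t ht => ?_
        rcases (hEj t ht).eq_or_lt with rfl | hlt
        · simp
        · simp [hlt.ne, hlt]) (by
        intro F
        choose E hE hEj using fun S : Δ => S.2.2.1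
        -- Finite satisfiability at stage `j`: the existence of a suitable `y` is a property of the
        -- coordinates below `j` in the limit type, so it already holds of `g`.
        have h := below (Set.Iio j) g (fun l hl => hg l hl)
          (fun z => ∃ y, ∀ S ∈ F, S.1 (Function.update z j y)) ((F.biUnion E).erase j)
          ((DefOver.forall_mem F fun S _ => S.2.1).exists_update j) (by
            intro z z' hzz
            refine exists_congr fun y => forall₂_congr fun S hS => hE S _ _ fun t ht => ?_
            by_cases htj : t = j
            · subst htj; simp
            · simp only [Function.update_of_ne htj]
              exact hzz t (Finset.mem_erase.2 ⟨htj, Finset.mem_biUnion.2 ⟨S, hS, ht⟩⟩)) (by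
            intro e he
            obtain ⟨hej, he⟩ := Finset.mem_erase.1 he
            obtain ⟨S, -, he⟩ := Finset.mem_biUnion.1 he
            exact lt_of_le_of_ne (hEj S e he) hej) (by
            have := (Filter.eventually_all_finset F).2 fun S (_ : S ∈ F) => S.2.2.2
            refine this.mono fun G hG => ⟨x G j, fun S hS => ?_⟩
            rw [Function.update_eq_self]
            exact hG S hS)
        exact h)
    exact ⟨m, fun S E hS hE hEj hSU => hm ⟨S, hS, ⟨E, hE, hEj⟩, hSU⟩⟩)
  refine ⟨g, fun γ => ?_⟩
  obtain ⟨E, hE⟩ := (hR γ).exists_supportedBy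
  exact below Set.univ g (fun l _ => hg l) (R γ) E (hR γ) hE (fun _ _ => trivial) (hU γ)

end Saturation


/-! ### Single dividing steps and cardinality bounds -/

section DivStep

variable {L : FirstOrder.Language.{u, v}} {M : Type w} [L.Structure M] {κ : Cardinal.{w}}

/-- Some formula over `C` that is satisfied by `a` divides over `B`; the dividing is witnessed by
automorphisms that fix `B` pointwise. -/
def DivStep (L : FirstOrder.Language.{u, v}) {M : Type w} [L.Structure M] {I : Type w}
    (B C : Set M) (a : I → M) : Prop :=
  ∃ (n : ℕ) (φ : L.Formula (I ⊕ Fin n)) (c : Fin n → M) (k : ℕ) (τ : ℕ → M ≃[L] M),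
    Set.range c ⊆ C ∧ Sat a (inst φ c) ∧ (∀ i, ∀ b ∈ B, τ i b = b) ∧
      KInconsistent φ (fun i => τ i ∘ c) k

variable {I : Type w}

theorem DivStep.mono {B B' C C' : Set M} {a : I → M} (h : DivStep L B C a) (hB : B' ⊆ B)
    (hC : C ⊆ C') : DivStep L B' C' a := by
  obtain ⟨n, φ, c, k, τ, hc, ha, hτ, hk⟩ := h
  exact ⟨n, φ, c, k, τ, hc.trans hC, ha, fun i b hb => hτ i b (hB hb), hk⟩

theorem KInconsistent.map {n k : ℕ} {φ : L.Formula (I ⊕ Fin n)} {c : ℕ → Fin n → M}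
    (h : KInconsistent φ c k) (σ : M ≃[L] M) : KInconsistent φ (fun i => σ ∘ c i) k := by
  rintro S hS ⟨x, hx⟩
  refine h S hS ⟨σ.symm ∘ x, fun i hi => ?_⟩
  have := hx i hi
  rw [sat_inst] at this ⊢
  rw [← Language.StrongHomClass.realize_formula σ]
  convert this using 1
  funext t
  cases t <;> simp

theorem DivStep.map {B C : Set M} {a : I → M} (h : DivStep L B C a) (σ : M ≃[L] M) :
    DivStep L (σ '' B) (σ '' C) (σ ∘ a) := by
  obtain ⟨n, φ, c, k, τ, hc, ha, hτ, hk⟩ := h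
  refine ⟨n, φ, σ ∘ c, k, fun i => (σ.comp (τ i)).comp σ.symm, ?_, ?_, ?_, ?_⟩
  · rw [Set.range_comp]
    exact Set.image_mono hc
  · rw [sat_inst] at ha ⊢
    rw [← Language.StrongHomClass.realize_formula σ] at ha
    rwa [Sum.comp_elim] at ha
  · rintro i _ ⟨b, hb, rfl⟩
    simp [hτ i b hb]
  · convert hk.map σ using 1
    funext i t
    simp

/-- A dividing formula may be given with infinitely many parameters. -/
theorem divStep_of_isDef {W : Type*} {B C : Set M} {a : I → M} {q : W → M}
    {P : (I ⊕ W → M) → Prop} (hP : IsDef L P) (ha : P (Sum.elim a q)) (hq : Set.range q ⊆ C)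
    (k : ℕ) (τ : ℕ → M ≃[L] M) (hτ : ∀ i, ∀ b ∈ B, τ i b = b)
    (hk : ∀ S : Finset ℕ, S.card = k → ¬ ∃ x, ∀ i ∈ S, P (Sum.elim x (τ i ∘ q))) :
    DivStep L B C a := by
  obtain ⟨n, χ, g, hg⟩ := hP.exists_finite_vars
  refine ⟨n, χ, q ∘ g, k, τ, (Set.range_comp_subset_range _ _).trans hq, ?_, hτ, ?_⟩
  · rwa [sat_inst, hg]
  · rintro S hS ⟨x, hx⟩
    refine hk S hS ⟨x, fun i hi => ?_⟩
    rw [← hg]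
    exact (sat_inst _ _ _).1 (hx i hi)

theorem mk_prod_nat_lt (hκ : ℵ₀ < κ) {ι : Type w} (hι : #ι < κ) : #(ι × ℕ) < κ := by
  simpa using mul_lt_of_lt hκ.le hι hκ

theorem mk_sigma_lt (hκ : ℵ₀ < κ) {ι : Type w} (hι : #ι < κ) (F : ι → Type)
    [∀ j, Countable (F j)] : #(Σ j, F j) < κ := by
  choose e he using fun j => exists_injective_nat (F j)
  refine (mk_le_of_injective (f := fun t : Σ j, F j => (t.1, e t.1 t.2)) ?_).trans_lt
    (mk_prod_nat_lt hκ hι)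
  rintro ⟨j, s⟩ ⟨j', s'⟩ h
  obtain ⟨rfl, h⟩ := Prod.mk.inj h
  exact congrArg (Sigma.mk j) (he j h)

theorem mk_sum_lt (hκ : ℵ₀ < κ) {X Y : Type w} (hX : #X < κ) (hY : #Y < κ) : #(X ⊕ Y) < κ := by
  simpa using add_lt_of_lt hκ.le hX hY

theorem mk_sum_fin_lt (hκ : ℵ₀ < κ) {X : Type w} (hX : #X < κ) (n : ℕ) : #(X ⊕ Fin n) < κ := by
  simpa using add_lt_of_lt hκ.le hX ((natCast_lt_aleph0 (n := n)).trans hκ)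

theorem mk_union_iUnion_lt (hκ : ℵ₀ < κ) {ι : Type w} (hι : #ι < κ) {A : Set M} (hA : #A < κ)
    {C : ι → Set M} (hC : ∀ j, (C j).Finite) (s : Set ι) :
    #(A ∪ ⋃ l ∈ s, C l : Set M) < κ := by
  refine mk_union_lt hκ hA ?_
  have : (⋃ l ∈ s, C l) ⊆ ⋃ l, C l := Set.iUnion₂_subset_iUnion _ _
  refine (mk_le_mk_of_subset this).trans_lt ((mk_iUnion_le_sum_mk).trans_lt ?_)
  refine (sum_le_sum _ (fun _ => ℵ₀) fun j => (hC j).lt_aleph0.le).trans_lt ?_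
  simpa using mul_lt_of_lt hκ.le hι hκ

end DivStep

/-! ### Splitting a dividing step between `a` and `b` -/

section Split

variable {L : FirstOrder.Language.{u, v}} {M : Type w} [L.Structure M] {κ : Cardinal.{w}}

/-- If a formula satisfied by `(a, b)` divides over `B`, then either some formula satisfied by `a`
divides over `B`, or some formula satisfied by `b` divides over `B` together with `a`. -/
theorem DivStep.split [Nonempty M] (hκ : ℵ₀ < κ) (hsat : IsSaturated L M κ)
    (hhom : IsStronglyHomogeneous L M κ) {I J : Type w} (hI : #I < κ) {a : I → M} {b : J → M}
    {B C : Set M} (hB : #B < κ) (h : DivStep L B C (Sum.elim a b)) :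
    DivStep L B (B ∪ C) a ∨ DivStep L (B ∪ Set.range a) (Set.range a ∪ C) b := by
  classical
  obtain ⟨n, φ, c, k, τ, hc, hab, hτ, hk⟩ := h
  rw [or_iff_not_imp_left]
  intro hnot
  have hX : #((B ⊕ I) ⊕ Fin n) < κ := mk_sum_fin_lt hκ (mk_sum_lt hκ hB hI) n
  let p : B ⊕ I → M := Sum.elim Subtype.val a
  -- Conditions on a sequence `d`: every `d i` has the type of `c` over `B` and `a`, and any `k` of
  -- the formulas `φ(a, y, d i)` are jointly inconsistent. Such a sequence witnesses division over
  -- `B` and `a`.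
  let Γ := (ℕ × {S : (Fin n → M) → Prop // DefOver L p S ∧ S c}) ⊕ {S : Finset ℕ // S.card = k}
  -- variables of `φ`, reading the `i`-th parameter tuple from a sequence of tuples
  let g : ℕ → (I ⊕ J) ⊕ Fin n → ((B ⊕ I) ⊕ (ℕ × Fin n)) ⊕ J := fun i =>
    Sum.elim (Sum.elim (fun t => Sum.inl (Sum.inl (Sum.inr t))) Sum.inr)
      fun t => Sum.inl (Sum.inr (i, t))
  have hg : ∀ (i : ℕ) (q : B → M) (x : I → M) (y : J → M) (d : ℕ × Fin n → M),
      (Sum.elim (Sum.elim (Sum.elim q x) d) y) ∘ g i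
        = Sum.elim (Sum.elim x y) fun t => d (i, t) := by
    intro i q x y d
    funext t
    rcases t with (t | t) | t <;> rfl
  let Inc : Finset ℕ → ((B ⊕ I) ⊕ (ℕ × Fin n) → M) → Prop := fun S z =>
    ¬ ∃ y : J → M, ∀ i ∈ S, φ.Realize (Sum.elim z y ∘ g i)
  have hInc : ∀ S, IsDef L (Inc S) := fun S =>
    (IsDef.forall_mem S fun i _ => (isDef_realize φ).comp (g i)).exists_tuple.not
  obtain ⟨d, hd⟩ := hsat.exists_forall hκ (Z := ULift.{w} (ℕ × Fin n))
    (mk_le_aleph0.trans_lt hκ) (p := p)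
    (mk_range_lt (mk_sum_lt hκ hB hI) _)
    (Sum.elim (fun s z => s.2.1 fun t => z ⟨s.1, t⟩)
      (fun S z => Inc S.1 (Sum.elim p (z ∘ ULift.up))) : Γ → _) (by
      rintro (⟨i, S, hS, -⟩ | ⟨S, hS⟩)
      · exact hS.comp fun t => ULift.up (i, t)
      · exact DefOver.comp ⟨_, hInc S, fun z => Iff.rfl⟩ ULift.up) (by
      intro F
      obtain ⟨N, hN⟩ : ∃ N : ℕ, (∀ s ∈ F.toLeft, s.1 < N) ∧ ∀ s ∈ F.toRight, ∀ i ∈ s.1, i < N := by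
        refine ⟨F.toLeft.sup (fun s => s.1 + 1) ⊔ F.toRight.sup (fun s => s.1.sup (· + 1)),
          fun s hs => ?_, fun s hs i hi => ?_⟩
        · exact lt_of_lt_of_le (Nat.lt_succ_self _)
            (le_sup_of_le_left (Finset.le_sup (f := fun s => s.1 + 1) hs))
        · exact lt_of_lt_of_le (Nat.lt_succ_self _) (le_sup_of_le_right
            ((Finset.le_sup (f := (· + 1)) hi).trans
              (Finset.le_sup (f := fun s : {S : Finset ℕ // S.card = k} => s.1.sup (· + 1)) hs)))
      obtain ⟨P, hP, hPR⟩ := DefOver.forall_mem (p := p) F.toLeft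
        (R := fun s : ℕ × {S : (Fin n → M) → Prop // DefOver L p S ∧ S c} => s.2.1)
        fun s _ => s.2.2.1
      -- the required finite configuration of parameter tuples exists over `(q, x)`
      let E : (B ⊕ I → M) → Prop := fun v => ∃ d : ℕ × Fin n → M,
        (∀ i ∈ Finset.range (N + 1), P (Sum.elim v fun t => d (i, t))) ∧
          ∀ s ∈ F.toRight, Inc s.1 (Sum.elim v d)
      have hE : IsDef L E := by
        refine IsDef.exists_tuple (P := fun z => (∀ i ∈ Finset.range (N + 1),
          P (z ∘ Sum.map id fun t => (i, t))) ∧ ∀ s ∈ F.toRight, Inc s.1 z)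
          ((IsDef.forall_mem _ fun i _ => hP.comp _).and
            (IsDef.forall_mem _ fun s _ => hInc s.1)) |>.congr fun v => ?_
        refine exists_congr fun d => and_congr_left fun _ => forall₂_congr fun i _ => ?_
        rw [Sum.elim_comp_map]
        rfl
      -- Otherwise `P(x, c) ∧ ¬E(x)` holds of `a` and divides over `B`, against `hnot`: if some `x`
      -- satisfied `N + 1` of its conjugates, the corresponding `τ i ∘ c` would form the very
      -- configuration that `¬E(x)` excludes.
      have hEa : E p := by
        by_contra hEa
        let r : (B ⊕ I) ⊕ Fin n → I ⊕ (B ⊕ Fin n) := Sum.elim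
          (Sum.elim (fun t => Sum.inr (Sum.inl t)) Sum.inl) fun t => Sum.inr (Sum.inr t)
        have hr : ∀ (x : I → M) (q : B → M) (e : Fin n → M),
            Sum.elim x (Sum.elim q e) ∘ r = Sum.elim (Sum.elim q x) e := by
          intro x q e
          funext t
          rcases t with (t | t) | t <;> rfl
        refine hnot (divStep_of_isDef (W := B ⊕ Fin n) (q := Sum.elim Subtype.val c)
          (P := fun v => P (v ∘ r) ∧ ¬ E (v ∘ r ∘ Sum.inl))
          ((hP.comp r).and (hE.comp _).not) ⟨?_, ?_⟩ ?_ (N + 1) τ hτ ?_)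
        · rw [hr]
          exact (hPR c).2 fun s _ => s.2.2.2
        · rw [← Function.comp_assoc, hr]
          exact hEa
        · rw [Set.Sum.elim_range, Subtype.range_coe]
          exact Set.union_subset_union_right _ hc
        · rintro S hS ⟨x, hx⟩
          have hτB : ∀ i, τ i ∘ (Sum.elim Subtype.val c : B ⊕ Fin n → M)
              = Sum.elim Subtype.val (τ i ∘ c) := by
            intro i
            funext t
            rcases t with t | t
            · exact hτ i t.1 t.2
            · rfl
          simp only [hτB, ← Function.comp_assoc, hr, Sum.elim_comp_inl] at hx
          let e := S.orderEmbOfFin hS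
          have heS : ∀ i, e i ∈ S := fun i => S.orderEmbOfFin_mem hS i
          -- Only indices at most `N` matter, so the reduction modulo `N + 1` is just a way to make
          -- the sequence total.
          refine (hx (e 0) (heS 0)).2 ⟨fun s => τ (e (Fin.ofNat (N + 1) s.1)) (c s.2),
            fun i _ => (hx _ (heS (Fin.ofNat (N + 1) i))).1, fun s hs => ?_⟩
          rintro ⟨y, hy⟩
          refine hk (s.1.image fun i => e (Fin.ofNat (N + 1) i)) ?_ ⟨Sum.elim x y, ?_⟩
          · rw [Finset.card_image_of_injOn, s.2]
            intro i hi i' hi' hii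
            have h1 : i < N + 1 := (hN.2 s hs i hi).trans (Nat.lt_succ_self _)
            have h2 : i' < N + 1 := (hN.2 s hs i' hi').trans (Nat.lt_succ_self _)
            have := congrArg Fin.val (e.injective hii)
            simpa [Fin.ofNat, Nat.mod_eq_of_lt h1, Nat.mod_eq_of_lt h2] using this
          · intro i hi
            obtain ⟨i₀, hi₀, rfl⟩ := Finset.mem_image.1 hi
            have := hy i₀ hi₀
            rw [hg] at this
            exact (sat_inst _ _ _).2 this
      obtain ⟨d, hd1, hd2⟩ := hEa
      refine ⟨fun s => d s.down, ?_⟩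
      rintro (s | s) hs
      · have hs' := Finset.mem_toLeft.2 hs
        exact (hPR _).1 (hd1 s.1 (Finset.mem_range.2 ((hN.1 s hs').trans (Nat.lt_succ_self _)))) s hs'
      · exact hd2 s (Finset.mem_toRight.2 hs))
  have hτ' : ∀ i : ℕ, ∃ σ : M ≃[L] M, ∀ t, σ (Sum.elim p c t) = Sum.elim p (fun t => d ⟨i, t⟩) t := by
    intro i
    refine hhom.exists_equiv _ _ (mk_range_lt hX _) fun P hP hPc => ?_
    exact hd (Sum.inl (i, ⟨fun z => P (Sum.elim p z), ⟨P, hP, fun _ => Iff.rfl⟩, hPc⟩))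
  choose τ' hτ' using hτ'
  refine divStep_of_isDef (W := I ⊕ Fin n) (q := Sum.elim a c) ((isDef_realize φ).comp
    (Sum.elim (Sum.elim (fun t => Sum.inr (Sum.inl t)) Sum.inl) fun t => Sum.inr (Sum.inr t)))
    ?_ ?_ k τ' ?_ ?_
  · rw [sat_inst] at hab
    convert hab using 1
    funext t
    rcases t with (t | t) | t <;> rfl
  · rw [Set.Sum.elim_range]
    exact Set.union_subset_union_right _ hc
  · rintro i m (hm | ⟨t, rfl⟩)
    · exact hτ' i (Sum.inl (Sum.inl ⟨m, hm⟩))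
    · exact hτ' i (Sum.inl (Sum.inr t))
  · rintro S hS ⟨y, hy⟩
    refine hd (Sum.inr ⟨S, hS⟩) ⟨y, fun i hi => ?_⟩
    rw [hg]
    convert hy i hi using 1
    funext t
    rcases t with (t | t) | t
    · exact (hτ' i (Sum.inl (Sum.inr t))).symm
    · rfl
    · exact (hτ' i (Sum.inr t)).symm

end Split


/-! ### Dividing trees indexed by a linear order -/

section Tree

variable {L : FirstOrder.Language.{u, v}} {M : Type w} [L.Structure M] {κ : Cardinal.{w}}
  {I : Type w}

/-- A dividing tree in `p` whose levels are indexed by the order `ι`. The parameters at level `j`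
are given as functions of a whole branch that depend only on the branch below `j`. -/
def HasTree (ι : Type*) [LinearOrder ι] (p : Set (PFormula L M I)) : Prop :=
  ∃ (n : ι → ℕ) (φ : ∀ j, L.Formula (I ⊕ Fin (n j))) (k : ι → ℕ)
    (c : ∀ j, (ι → ℕ) → ℕ → Fin (n j) → M),
    (∀ j f g, (∀ l < j, f l = g l) → c j f = c j g) ∧
    (∀ j f, KInconsistent (φ j) (c j f) (k j)) ∧
    ∀ f, Consistent (p ∪ Set.range fun j => inst (φ j) (c j f (f j)))

/-- Nodes and whole branches carry the same data: a branch restricts to a node, and a node extends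
by `0` to a branch, the choice being immaterial by locality. -/
theorem plusLeDD_iff_hasTree {ι : Type*} [LinearOrder ι] {α : Ordinal.{w}} (e : Set.Iio α ≃o ι)
    (p : Set (PFormula L M I)) : PlusLeDD p α ↔ HasTree ι p := by
  constructor
  · rintro ⟨n, φ, k, c, hk, hc⟩
    refine ⟨fun j => n (e.symm j), fun j => φ (e.symm j), fun j => k (e.symm j),
      fun j f => c (e.symm j) (restrict (f ∘ e) (e.symm j)), ?_, fun j f => hk _ _, fun f => ?_⟩
    · intro j f g hfg
      refine congrArg (c (e.symm j)) (funext fun l => ?_)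
      exact hfg _ (e.lt_symm_apply.1 l.2)
    · convert hc (f ∘ e) using 2
      rw [← e.symm.surjective.range_comp]
      congr 1
      funext j
      simp
  · rintro ⟨n, φ, k, c, hloc, hk, hc⟩
    let ext : ∀ j : Set.Iio α, (Set.Iio (j : Ordinal.{w}) → ℕ) → ι → ℕ := fun j s l =>
      if h : e.symm l < j then s ⟨e.symm l, h⟩ else 0
    refine ⟨fun j => n (e j), fun j => φ (e j), fun j => k (e j), fun j s => c (e j) (ext j s),
      fun j s => hk _ _, fun f => ?_⟩
    convert hc (f ∘ e.symm) using 2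
    rw [← e.surjective.range_comp]
    congr 1
    funext j
    simp only [Function.comp_apply, OrderIso.symm_apply_apply]
    rw [hloc (e j) (ext j (restrict f j)) (f ∘ e.symm)]
    intro l hl
    have hl' : e.symm l < j := e.symm_apply_lt.2 hl
    simp only [ext, dif_pos hl']
    rfl

end Tree

/-! ### From a dividing tree to a chain -/

section TreeToChain

variable {L : FirstOrder.Language.{u, v}} {M : Type w} [L.Structure M] {κ : Cardinal.{w}}
  {I : Type w}

/-- A dividing tree in `tp(a/A)` yields a chain of formulas satisfied by `a`, each dividing over
`A` and the parameters of the earlier ones. -/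
theorem HasTree.exists_divStep [Nonempty M] (hκ : ℵ₀ < κ) (hsat : IsSaturated L M κ)
    (hhom : IsStronglyHomogeneous L M κ) (hI : #I < κ) {a : I → M} {A : Set M} (hA : #A < κ)
    {ι : Type w} [LinearOrder ι] [WellFoundedLT ι] (hι : #ι < κ) (h : HasTree ι (tp L a A)) :
    ∃ C : ι → Set M, (∀ j, (C j).Finite) ∧
      ∀ j, DivStep L (A ∪ ⋃ l ∈ Set.Iio j, C l) (C j) a := by
  classical
  obtain ⟨n, φ, k, c, hloc, hk, hc⟩ := h
  let Z := I ⊕ ((Σ j, Fin (n j)) ⊕ (Σ j, ℕ × Fin (n j)))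
  have hZ : #Z < κ := mk_sum_lt hκ hI
    (mk_sum_lt hκ (mk_sigma_lt hκ hι _) (mk_sigma_lt hκ hι _))
  let Below : ι → Type w := fun j => (Σ l : Set.Iio j, Fin (n l)) ⊕ Fin (n j)
  have hBelow : ∀ j, #(Below j) < κ := fun j =>
    mk_sum_fin_lt hκ (mk_sigma_lt hκ ((mk_set_le _).trans_lt hι) _) _
  -- The unknowns are a tuple `x`, a branch of parameters, and a sequence of siblings at each level.
  -- The conditions say that `x` realizes `tp(a/A)` and the formulas on the branch, that the
  -- siblings at level `j` are `k j`-inconsistent, and that each has the type over `A` and the lower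
  -- branch of the parameter at `j`.
  let Γ := tp L a A ⊕ (ι ⊕ ({q : ι × Finset ℕ // q.2.card = k q.1} ⊕
    (Σ j, ℕ × {S : (Below j → M) → Prop // DefOver L (Subtype.val : A → M) S})))
  let g₂ : ∀ j, I ⊕ Fin (n j) → Z := fun j => Sum.elim Sum.inl fun t => Sum.inr (Sum.inl ⟨j, t⟩)
  let g₃ : ∀ j, ℕ → I ⊕ Fin (n j) → Z ⊕ I := fun j i =>
    Sum.elim Sum.inr fun t => Sum.inl (Sum.inr (Sum.inr ⟨j, i, t⟩))
  let b₀ : ∀ j, Below j → Z := fun j => Sum.elim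
    (fun s => Sum.inr (Sum.inl ⟨s.1, s.2⟩)) fun t => Sum.inr (Sum.inl ⟨j, t⟩)
  let b₁ : ∀ j, ℕ → Below j → Z := fun j i => Sum.elim
    (fun s => Sum.inr (Sum.inl ⟨s.1, s.2⟩)) fun t => Sum.inr (Sum.inr ⟨j, i, t⟩)
  obtain ⟨z, hz⟩ := hsat.exists_forall hκ hZ (p := (Subtype.val : A → M))
    (mk_range_lt hA _)
    (Sum.elim (fun ψ z => Sat (z ∘ Sum.inl) ψ.1)
      (Sum.elim (fun j z => (φ j).Realize (z ∘ g₂ j))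
        (Sum.elim
          (fun q z => ¬ ∃ x : I → M, ∀ i ∈ q.1.2, (φ q.1.1).Realize (Sum.elim z x ∘ g₃ q.1.1 i))
          fun q z => (q.2.2.1 (z ∘ b₀ q.1) ↔ q.2.2.1 (z ∘ b₁ q.1 q.2.1)))) : Γ → _) (by
      rintro (ψ | j | q | ⟨j, i, S, hS⟩)
      · exact (defOver_of_mem_formulasOver ψ.2.1).comp Sum.inl
      · exact ((isDef_realize (φ j)).comp (g₂ j)).defOver _
      · exact (IsDef.forall_mem q.1.2 fun i _ =>
          (isDef_realize (φ q.1.1)).comp (g₃ q.1.1 i)).exists_tuple.not.defOver _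
      · exact (hS.comp (b₀ j)).iff (hS.comp (b₁ j i))) (by
      intro F
      let Δ : ∀ j, Finset {S : (Below j → M) → Prop // DefOver L (Subtype.val : A → M) S} :=
        fun j => (F.toRight.toRight.toRight.preimage (Sigma.mk j)
          sigma_mk_injective.injOn).image Prod.snd
      let node : ∀ j, (ι → ℕ) → ℕ → Below j → M := fun j f i =>
        Sum.elim (fun s => c s.1 f (f s.1) s.2) (c j f i)
      -- Only finitely many predicates `Δ j` are tested at level `j`, so by pigeonhole some child
      -- agrees on them with infinitely many of its siblings; the branch passes through such a
      -- child.
      obtain ⟨f, hf⟩ := exists_forall_of_wellFoundedLT (C := fun _ : ι => ℕ)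
        (fun j f m => {i | ∀ S ∈ Δ j, (S.1 (node j f m) ↔ S.1 (node j f i))}.Infinite) (by
        intro j f g hfg m hm
        have : node j f = node j g := by
          funext i t
          rcases t with ⟨l, t⟩ | t
          · change c l f (f l) t = c l g (g l) t
            rw [hfg l l.2, hloc l f g fun t ht => hfg t (ht.trans l.2)]
          · change c j f i t = c j g i t
            rw [hloc j f g hfg]
        rwa [← this]) (by
        intro j f _
        obtain ⟨y, hy⟩ := Finite.exists_infinite_fiber
          fun (i : ℕ) (S : Δ j) => S.1.1 (node j f i)
        have hy := Set.infinite_coe_iff.1 hy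
        obtain ⟨m, hm⟩ := hy.nonempty
        refine ⟨m, hy.mono fun i hi S hS => ?_⟩
        have h1 := congrFun hm ⟨S, hS⟩
        have h2 := congrFun hi ⟨S, hS⟩
        exact iff_of_eq (h1.trans h2.symm))
      let e : ∀ j, ℕ ↪ _ := fun j => (hf j).natEmbedding
      obtain ⟨x, hx⟩ := hc f (F.toLeft.image Subtype.val ∪
        F.toRight.toLeft.image fun j => inst (φ j) (c j f (f j))) (by
          intro ψ hψ
          rcases Finset.mem_union.1 hψ with hψ | hψ
          · obtain ⟨ψ, -, rfl⟩ := Finset.mem_image.1 hψ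
            exact Or.inl ψ.2
          · obtain ⟨j, -, rfl⟩ := Finset.mem_image.1 hψ
            exact Or.inr ⟨j, rfl⟩)
      refine ⟨Sum.elim x (Sum.elim (fun s => c s.1 f (f s.1) s.2)
        fun s => c s.1 f (e s.1 s.2.1) s.2.2), ?_⟩
      rintro (ψ | j | ⟨⟨j, S⟩, hS⟩ | ⟨j, i, S⟩) hF
      · exact hx ψ.1 (Finset.mem_union_left _
          (Finset.mem_image_of_mem _ (Finset.mem_toLeft.2 hF)))
      · have := hx _ (Finset.mem_union_right _ (Finset.mem_image_of_mem _
          (Finset.mem_toLeft.2 (Finset.mem_toRight.2 hF))))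
        rw [sat_inst] at this
        change (φ j).Realize (_ ∘ g₂ j)
        convert this using 1
        funext t
        rcases t with t | t <;> rfl
      · rintro ⟨y, hy⟩
        refine hk j f (S.image fun i => (e j i : ℕ)) ?_ ⟨y, fun i hi => ?_⟩
        · exact (Finset.card_image_of_injective _
            (Subtype.val_injective.comp (e j).injective)).trans hS
        · obtain ⟨i₀, hi₀, rfl⟩ := Finset.mem_image.1 hi
          rw [sat_inst]
          convert hy i₀ hi₀ using 1
          funext t
          rcases t with t | t <;> rfl
      · have hS : S ∈ Δ j := Finset.mem_image.2 ⟨(i, S), Finset.mem_preimage.2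
          (Finset.mem_toRight.2 (Finset.mem_toRight.2 (Finset.mem_toRight.2 hF))), rfl⟩
        change S.1 (_ ∘ b₀ j) ↔ S.1 (_ ∘ b₁ j i)
        convert (e j i).2 S hS using 2
        · funext t
          rcases t with t | t <;> rfl
        · funext t
          rcases t with t | t <;> rfl)
  -- The chain found belongs to another realization of `tp(a/A)`; an automorphism over `A` will
  -- carry it back to `a`.
  obtain ⟨σ, hσ⟩ := hhom.exists_equiv (X := A ⊕ I) (Sum.elim Subtype.val a)
    (Sum.elim Subtype.val (z ∘ Sum.inl)) (mk_range_lt (mk_sum_lt hκ hA hI) _) (by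
      intro P hP ha
      obtain ⟨ψ, hψ, hψP⟩ := exists_mem_formulasOver (R := fun x => P (Sum.elim Subtype.val x))
        (B := A) ⟨P, hP, fun _ => Iff.rfl⟩ Subtype.range_coe.subset
      exact (hψP _).1 (hz (Sum.inl ⟨ψ, hψ, (hψP a).2 ha⟩)))
  have hσa : a = σ.symm ∘ (z ∘ Sum.inl) := by
    funext t
    have h : σ (a t) = (z ∘ Sum.inl) t := hσ (Sum.inr t)
    rw [Function.comp_apply, ← h, Language.Equiv.symm_apply_apply]
  let C : ι → Set M := fun j => Set.range fun t => z (Sum.inr (Sum.inl ⟨j, t⟩))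
  refine ⟨fun j => σ.symm '' C j, fun j => (Set.finite_range _).image _, fun j => ?_⟩
  have hτ : ∀ i : ℕ, ∃ τ : M ≃[L] M, ∀ t, τ (Sum.elim Subtype.val (z ∘ b₀ j) t)
      = Sum.elim (Subtype.val : A → M) (z ∘ b₁ j i) t := by
    intro i
    refine hhom.exists_equiv _ _ (mk_range_lt (mk_sum_lt hκ hA (hBelow j)) _) fun P hP h => ?_
    exact (hz (Sum.inr (Sum.inr (Sum.inr ⟨j, i, _, P, hP, fun _ => Iff.rfl⟩)))).1 h
  choose τ hτ using hτ
  have hdiv : DivStep L (A ∪ ⋃ l ∈ Set.Iio j, C l) (C j) (z ∘ Sum.inl) := by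
    refine ⟨n j, φ j, fun t => z (Sum.inr (Sum.inl ⟨j, t⟩)), k j, τ, subset_rfl, ?_, ?_, ?_⟩
    · rw [sat_inst]
      have h : (φ j).Realize (z ∘ g₂ j) := hz (Sum.inr (Sum.inl j))
      convert h using 1
      funext t
      rcases t with t | t <;> rfl
    · rintro i m (hm | hm)
      · exact hτ i (Sum.inl ⟨m, hm⟩)
      · obtain ⟨l, hl, t, rfl⟩ := Set.mem_iUnion₂.1 hm
        exact hτ i (Sum.inr (Sum.inl ⟨⟨l, hl⟩, t⟩))
    · rintro S hS ⟨x, hx⟩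
      refine hz (Sum.inr (Sum.inr (Sum.inl ⟨(j, S), hS⟩))) ⟨x, fun i hi => ?_⟩
      have := hx i hi
      rw [sat_inst] at this
      convert this using 1
      funext t
      rcases t with t | t
      · rfl
      · exact (hτ i (Sum.inr (Sum.inr t))).symm
  rw [hσa]
  refine (hdiv.map σ.symm).mono ?_ subset_rfl
  rintro m (hm | hm)
  · refine ⟨m, Or.inl hm, ?_⟩
    have h : σ m = m := hσ (Sum.inl ⟨m, hm⟩)
    conv_lhs => rw [← h]
    exact σ.symm_apply_apply m
  · obtain ⟨l, hl, m₀, hm₀, rfl⟩ := Set.mem_iUnion₂.1 hm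
    exact ⟨m₀, Or.inr (Set.mem_iUnion₂.2 ⟨l, hl, hm₀⟩), rfl⟩

end TreeToChain


/-! ### From a chain to a dividing tree -/

section ChainToTree

variable {L : FirstOrder.Language.{u, v}} {M : Type w} [L.Structure M] {κ : Cardinal.{w}}
  {I : Type w}

/-- A chain of formulas satisfied by `a`, each dividing over `A` and the parameters of the earlier
ones, yields a dividing tree in `tp(a/A)`. -/
theorem hasTree_of_divStep (hκ : ℵ₀ < κ) (hhom : IsStronglyHomogeneous L M κ) {a : I → M}
    {A : Set M} (hA : #A < κ) {ι : Type w} [LinearOrder ι] [WellFoundedLT ι] (hι : #ι < κ)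
    {B C : ι → Set M} (hAB : ∀ j, A ⊆ B j) (hCB : ∀ l j, l < j → C l ⊆ B j)
    (h : ∀ j, DivStep L (B j) (C j) a) : HasTree ι (tp L a A) := by
  classical
  choose n φ c k τ hcC ha hτ hk using h
  have hτA : ∀ j i, ∀ m ∈ A, τ j i m = m := fun j i m hm => hτ j i m (hAB j hm)
  have hτc : ∀ j i l, l < j → ∀ t, τ j i (c l t) = c l t := fun j i l hl t =>
    hτ j i _ (hCB l j hl (hcC l ⟨t, rfl⟩))
  -- `m` maps the chain below `j` to the branch `f` of the tree given by `σ`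
  let Good : (∀ l : ι, (ι → ℕ) → M ≃[L] M) → (ι → ℕ) → Set ι → (M ≃[L] M) → Prop :=
    fun σ f s m => (∀ b ∈ A, m b = b) ∧ ∀ l ∈ s, ∀ t, m (c l t) = σ l f (τ l (f l) (c l t))
  have hfinite : ∀ (σ : ∀ l : ι, (ι → ℕ) → M ≃[L] M) (f : ι → ℕ) (E : Finset ι),
      (∀ l ∈ E, Good σ f (Set.Iio l) (σ l f)) → ∃ m, Good σ f E m := by
    intro σ f E hE
    rcases E.eq_empty_or_nonempty with rfl | hne
    · exact ⟨Language.Equiv.refl L M, fun _ _ => rfl, by simp⟩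
    -- For finitely many levels the largest, `j`, decides: `τ j (f j)` fixes the earlier parameters,
    -- which `σ j f` then places correctly, and `c j` lands where required by definition.
    · set j := E.max' hne with hj
      have hσj := hE j (E.max'_mem hne)
      refine ⟨(σ j f).comp (τ j (f j)), fun b hb => ?_, fun l hl t => ?_⟩
      · rw [Language.Equiv.comp_apply, hτA j _ b hb, hσj.1 b hb]
      · rw [Language.Equiv.comp_apply]
        rcases (E.le_max' l hl).eq_or_lt with hlj | hlt
        · rw [← hj] at hlj
          subst hlj
          rfl
        · rw [hτc j _ l hlt, hσj.2 l hlt]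
  obtain ⟨σ, hσ⟩ := exists_forall_of_wellFoundedLT
    (C := fun _ : ι => (ι → ℕ) → M ≃[L] M)
    (fun j σ m => (∀ f g, (∀ l < j, f l = g l) → m f = m g) ∧
      ∀ f, Good σ f (Set.Iio j) (m f)) (by
    intro j σ σ' hσσ m hm
    refine ⟨hm.1, fun f => ⟨(hm.2 f).1, fun l hl t => ?_⟩⟩
    rw [← hσσ l hl]
    exact (hm.2 f).2 l hl t) (by
    intro j σ hσ
    -- Each formula mentions finitely many levels, so `hfinite` shows that the chain below `j` and
    -- its intended image have the same type over `A`; strong homogeneity then treats all levels at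
    -- once.
    have hex : ∀ f, ∃ m, Good σ f (Set.Iio j) m := by
      intro f
      obtain ⟨m, hm⟩ := hhom.exists_equiv (X := A ⊕ Σ l : Set.Iio j, Fin (n l))
        (Sum.elim Subtype.val fun s => c s.1 s.2)
        (Sum.elim Subtype.val fun s => σ s.1 f (τ s.1 (f s.1) (c s.1 s.2)))
        (mk_range_lt (mk_sum_lt hκ hA (mk_sigma_lt hκ ((mk_set_le _).trans_lt hι) _)) _) (by
        intro P hP hPc
        obtain ⟨E, hE⟩ := hP.exists_supportedBy
        obtain ⟨m, hm⟩ := hfinite σ f (E.toRight.image fun s => s.1.1) (by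
          intro l hl
          obtain ⟨s, -, rfl⟩ := Finset.mem_image.1 hl
          exact (hσ s.1.1 s.1.2).2 f)
        refine (hE _ _ fun t ht => ?_).1 ((hP.map_iff m _).2 hPc)
        rcases t with t | s
        · exact hm.1 t.1 t.2
        · exact hm.2 s.1.1 (Finset.mem_image.2 ⟨s, Finset.mem_toRight.2 ht, rfl⟩) s.2)
      exact ⟨m, fun b hb => hm (Sum.inl ⟨b, hb⟩), fun l hl t => hm (Sum.inr ⟨⟨l, hl⟩, t⟩)⟩
    choose m hm using hex
    -- Truncating the branch at `j` before choosing makes the automorphism depend only on the node.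
    refine ⟨fun f => m fun l => if l < j then f l else 0, fun f g hfg => ?_, fun f => ?_⟩
    · refine congrArg m (funext fun l => ?_)
      by_cases hl : l < j
      · rw [if_pos hl, if_pos hl, hfg l hl]
      · rw [if_neg hl, if_neg hl]
    · refine ⟨(hm _).1, fun l hl t => ?_⟩
      have hlj : l < j := hl
      rw [(hm _).2 l hl, if_pos hlj, (hσ l hl).1 (fun l => if l < j then f l else 0) f]
      intro l' hl'
      rw [if_pos (hl'.trans hlj)])
  refine ⟨n, φ, k, fun j f i => σ j f ∘ τ j i ∘ c j, ?_, fun j f => (hk j).map (σ j f), ?_⟩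
  · intro j f g hfg
    simp only [(hσ j).1 f g hfg]
  · intro f F hF
    let q : ι → PFormula L M I := fun j => inst (φ j) (σ j f ∘ τ j (f j) ∘ c j)
    obtain ⟨E, -, hE⟩ := Finset.subset_set_image_iff.1
      (show ((F.filter (· ∈ Set.range q) : Finset _) : Set _) ⊆ q '' Set.univ by
        intro ψ hψ
        rw [Set.image_univ]
        exact (Finset.mem_filter.1 hψ).2)
    -- Consistency along `f` is finitary, so the image of `a` under an automorphism that is correct
    -- on finitely many levels suffices.
    obtain ⟨m, hm⟩ := hfinite σ f E fun l _ => (hσ l).2 f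
    refine ⟨m ∘ a, fun ψ hψ => ?_⟩
    by_cases hr : ψ ∈ Set.range q
    · obtain ⟨l, hl, rfl⟩ := Finset.mem_image.1
        (hE.symm ▸ Finset.mem_filter.2 ⟨hψ, hr⟩ : ψ ∈ E.image q)
      have := (sat_inst _ _ _).1 (ha l)
      rw [← Language.StrongHomClass.realize_formula m] at this
      refine (sat_inst _ _ _).2 ?_
      convert this using 1
      funext t
      rcases t with t | t
      · rfl
      · exact (hm.2 l hl t).symm
    · rcases hF hψ with hψ | hψ
      · obtain ⟨P, hP, hPR⟩ := defOver_of_mem_formulasOver hψ.1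
        have h1 := (hP.map_iff m _).2 ((hPR a).2 hψ.2)
        refine (hPR _).1 ?_
        convert h1 using 1
        funext t
        rcases t with t | t
        · exact (hm.1 t.1 t.2).symm
        · rfl
      · exact absurd hψ hr

end ChainToTree

end DividingDepth

/-! ### Natural sums and partitions of well-orders -/

section NatSum

theorem natSum_lt_natSum_left {a a' : Ordinal.{w}} (h : a' < a) (b : Ordinal.{w}) :
    natSum a' b < natSum a b := by
  rw [natSum.eq_1 a b]
  refine lt_of_lt_of_le (Order.lt_succ _) (le_max_of_le_left ?_)
  exact le_ciSup (f := fun x : Set.Iio a => Order.succ (natSum x.1 b))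
    Ordinal.bddAbove_of_small ⟨a', h⟩

theorem natSum_lt_natSum_right (a : Ordinal.{w}) {b b' : Ordinal.{w}} (h : b' < b) :
    natSum a b' < natSum a b := by
  rw [natSum.eq_1 a b]
  refine lt_of_lt_of_le (Order.lt_succ _) (le_max_of_le_right ?_)
  exact le_ciSup (f := fun x : Set.Iio b => Order.succ (natSum a x.1))
    Ordinal.bddAbove_of_small ⟨b', h⟩

theorem natSum_le_natSum {a a' b b' : Ordinal.{w}} (ha : a' ≤ a) (hb : b' ≤ b) :
    natSum a' b' ≤ natSum a b := by
  have h1 : natSum a' b' ≤ natSum a b' := by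
    rcases ha.eq_or_lt with rfl | h
    · rfl
    · exact (natSum_lt_natSum_left h _).le
  have h2 : natSum a b' ≤ natSum a b := by
    rcases hb.eq_or_lt with rfl | h
    · rfl
    · exact (natSum_lt_natSum_right _ h).le
  exact h1.trans h2

open Ordinal in
/-- The order type of a well-order is at most the natural sum of the order types of a subset and
its complement. -/
theorem type_le_natSum {ι : Type w} [LinearOrder ι] [WellFoundedLT ι] (X : Set ι) :
    typeLT ι ≤ natSum (typeLT X) (typeLT (Xᶜ : Set ι)) := by
  -- This plays the role of the order type of the part of `X` below `i`. Passing any `i` strictly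
  -- raises the rank for `X` or for `Xᶜ`, so the natural sum `g` of the two ranks is strictly
  -- increasing and dominates the position of `i` in `ι`.
  let r : Set ι → ι → Ordinal.{w} := fun X i =>
    ⨆ x : {x : X // x.1 < i}, Order.succ (typein (· < · : X → X → Prop) x.1)
  have hr_le : ∀ (X : Set ι) i, r X i ≤ typeLT X := fun X i =>
    Ordinal.iSup_le fun x => Order.succ_le_of_lt (typein_lt_type _ _)
  have hr_mono : ∀ (X : Set ι) i i', i ≤ i' → r X i ≤ r X i' := fun X i i' h =>
    Ordinal.iSup_le fun x =>
      Ordinal.le_iSup (fun x : {x : X // x.1 < i'} => Order.succ (typein (· < · : X → X → Prop) x.1))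
        ⟨x.1, x.2.trans_le h⟩
  have hr_mem : ∀ (X : Set ι) i (hi : i ∈ X), r X i ≤ typein (· < · : X → X → Prop) ⟨i, hi⟩ :=
    fun X i hi => Ordinal.iSup_le fun x => Order.succ_le_of_lt ((typein_lt_typein _).2 x.2)
  have hr_lt : ∀ (X : Set ι) i i', i ∈ X → i < i' → r X i < r X i' := fun X i i' hi h =>
    (Order.lt_succ_of_le (hr_mem X i hi)).trans_le
      (Ordinal.le_iSup (fun x : {x : X // x.1 < i'} =>
        Order.succ (typein (· < · : X → X → Prop) x.1)) ⟨⟨i, hi⟩, h⟩)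
  have hr_lt_type : ∀ (X : Set ι) i, i ∈ X → r X i < typeLT X := fun X i hi =>
    (hr_mem X i hi).trans_lt (typein_lt_type _ _)
  let g : ι → Ordinal.{w} := fun i => natSum (r X i) (r Xᶜ i)
  have hg_lt : ∀ i i', i < i' → g i < g i' := by
    intro i i' h
    by_cases hi : i ∈ X
    · exact (natSum_lt_natSum_left (hr_lt X i i' hi h) _).trans_le
        (natSum_le_natSum le_rfl (hr_mono _ _ _ h.le))
    · exact (natSum_lt_natSum_right _ (hr_lt Xᶜ i i' hi h)).trans_le
        (natSum_le_natSum (hr_mono _ _ _ h.le) le_rfl)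
  have hg_lt_type : ∀ i, g i < natSum (typeLT X) (typeLT (Xᶜ : Set ι)) := by
    intro i
    by_cases hi : i ∈ X
    · exact (natSum_lt_natSum_left (hr_lt_type X i hi) _).trans_le
        (natSum_le_natSum le_rfl (hr_le _ _))
    · exact (natSum_lt_natSum_right _ (hr_lt_type Xᶜ i hi)).trans_le
        (natSum_le_natSum (hr_le _ _) le_rfl)
  have htypein : ∀ i, typein (· < · : ι → ι → Prop) i ≤ g i := by
    intro i
    induction i using (wellFounded_lt (α := ι)).induction with
    | _ i ih =>
      refine le_of_forall_lt fun δ hδ => ?_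
      obtain ⟨l, rfl⟩ := typein_surj (· < · : ι → ι → Prop) (hδ.trans (typein_lt_type _ _))
      have hl := (typein_lt_typein _).1 hδ
      exact (ih l hl).trans_lt (hg_lt l i hl)
  refine le_of_forall_lt fun δ hδ => ?_
  obtain ⟨l, rfl⟩ := typein_surj (· < · : ι → ι → Prop) hδ
  exact (htypein l).trans_lt (hg_lt_type l)

end NatSum

/-! ### Additivity of the dividing depth -/

theorem mainTheorem4 (L : FirstOrder.Language.{u, v}) (M : Type w) [L.Structure M] [Nonempty M]
    (κ : Cardinal.{w}) (hκ : ℵ₀ < κ)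
    (hsat : DividingDepth.IsSaturated L M κ) (hhom : DividingDepth.IsStronglyHomogeneous L M κ)
    (A : Set M) (hA : #A < κ)
    (I J : Type w) (hI : #I < κ) (hJ : #J < κ) (a : I → M) (b : J → M)
    (α : Ordinal.{w}) (hα : α.card < κ)
    (h : DividingDepth.PlusLeDD (DividingDepth.tp L (Sum.elim a b) A) α) :
    ∃ β γ : Ordinal.{w}, α ≤ natSum β γ ∧
      DividingDepth.PlusLeDD (DividingDepth.tp L a A) β ∧
      DividingDepth.PlusLeDD (DividingDepth.tp L b (A ∪ Set.range a)) γ := by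
  classical
  obtain ⟨ι, _, _, rfl⟩ : ∃ (ι : Type w) (_ : LinearOrder ι) (_ : WellFoundedLT ι),
      Ordinal.type (· < · : ι → ι → Prop) = α :=
    ⟨α.ToType, inferInstance, inferInstance, Ordinal.type_toType α⟩
  rw [Ordinal.card_type] at hα
  have toIso : ∀ (ι : Type w) [LinearOrder ι] [WellFoundedLT ι],
      Nonempty (Set.Iio (Ordinal.type (· < · : ι → ι → Prop)) ≃o ι) := fun ι _ _ =>
    ⟨OrderIso.ofRelIsoLT (Ordinal.enum (· < · : ι → ι → Prop))⟩
  obtain ⟨e⟩ := toIso ι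
  rw [DividingDepth.plusLeDD_iff_hasTree e] at h
  obtain ⟨C, hCfin, hC⟩ := h.exists_divStep hκ hsat hhom
    (DividingDepth.mk_sum_lt hκ hI hJ) hA hα
  let B : ι → Set M := fun j => A ∪ ⋃ l ∈ Set.Iio j, C l
  have hB : ∀ j, #(B j) < κ := fun j => DividingDepth.mk_union_iUnion_lt hκ hα hA hCfin _
  have hBC : ∀ l j, l < j → B l ∪ C l ⊆ B j := by
    rintro l j hlj m ((hm | hm) | hm)
    · exact Or.inl hm
    · obtain ⟨l', hl', hm⟩ := Set.mem_iUnion₂.1 hm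
      exact Or.inr (Set.mem_iUnion₂.2 ⟨l', lt_trans hl' hlj, hm⟩)
    · exact Or.inr (Set.mem_iUnion₂.2 ⟨l, hlj, hm⟩)
  -- The formula for `a` produced by splitting may use parameters from `B j` as well as `C j`. Both
  -- lie in every later base, so the steps in `X` still form a chain.
  let X : Set ι := {j | DividingDepth.DivStep L (B j) (B j ∪ C j) a}
  have hX : ∀ j ∈ Xᶜ, DividingDepth.DivStep L (B j ∪ Set.range a) (Set.range a ∪ C j) b :=
    fun j hj => ((hC j).split hκ hsat hhom hI (hB j)).resolve_left hj
  obtain ⟨eX⟩ := toIso X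
  obtain ⟨eY⟩ := toIso (Xᶜ : Set ι)
  refine ⟨_, _, type_le_natSum X, (DividingDepth.plusLeDD_iff_hasTree eX _).2 ?_,
    (DividingDepth.plusLeDD_iff_hasTree eY _).2 ?_⟩
  · exact DividingDepth.hasTree_of_divStep hκ hhom hA ((mk_set_le _).trans_lt hα)
      (B := fun j : X => B j) (C := fun j : X => B j ∪ C j) (fun j => Set.subset_union_left)
      (fun l j hlj => hBC l j hlj) fun j => j.2
  · refine DividingDepth.hasTree_of_divStep hκ hhom
      (DividingDepth.mk_union_lt hκ hA (DividingDepth.mk_range_lt hI a))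
      ((mk_set_le _).trans_lt hα) (B := fun j : (Xᶜ : Set ι) => B j ∪ Set.range a)
      (C := fun j : (Xᶜ : Set ι) => Set.range a ∪ C j)
      (fun j => Set.union_subset_union_left _ Set.subset_union_left) (fun l j hlj => ?_)
      fun j => hX j j.2
    exact Set.union_subset Set.subset_union_right
      ((Set.subset_union_right.trans (hBC l j hlj)).trans Set.subset_union_left)
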